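/- Let $\Gamma\subset \mathrm{PSL}_2(\mathbb R)$ be a discrete group acting freely on the hyperbolic plane $\mathbb H$ with compact quotient $X=\Gamma\backslash\mathbb H$, let $\rho:\Gamma\to U(V_\rho)$ be a unitary representation on a finite-dimensional complex inner product space $V_\rho$, let $n\ge 0$ and let $\phi_n:\Gamma\to\mathcal S_n$ be a homomorphism to the group of permutations of $[n]=\{1,\dots,n\}$. Let $\Gamma$ act on $\mathbb H\times[n]$ by $\gamma(z,j)=(\gamma z,\phi_n(\gamma)(j))$ and let $X_n=\Gamma\backslash(\mathbb H\times[n])$ be the corresponding (possibly disconnected) cover of $X$ of degree $n$. For a finite-dimensional unitary representation $\varrho:\Gamma\to U(W)$, the twisted Laplacian $\Delta_\varrho$ on $X$ is the closure, in the Hilbert space $L^2(F;W)$ with respect to hyperbolic area on a compact fundamental domain $F$ of $\Gamma$ in $\mathbb H$, of the hyperbolic Laplacian $-y^2(\partial_x^2+\partial_y^2)$ on the smooth functions $\psi:\mathbb H\to W$ with $\psi(\gamma z)=\varrho(\gamma)\psi(z)$ for all $\gamma\in\Gamma$. Likewise $\Delta_{n,\rho}$ on $X_n$ is the closure, in $L^2(D;V_\rho)$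 for a compact fundamental domain $D$ of $\Gamma$ in $\mathbb H\times[n]$, of the hyperbolic Laplacian (acting on each copy of $\mathbb H$) on the smooth functions $\psi:\mathbb H\times[n]\to V_\rho$ with $\psi(\gamma z,\phi_n(\gamma)(j))=\rho(\gamma)\psi(z,j)$ for all $\gamma\in\Gamma$. Then there is a unitary representation $\varrho_n:\Gamma\to U(V_n)$ on $V_n=V_\rho^{\,n}$ (orthogonal direct sum), of dimension $\dim V_n=n\dim V_\rho$, such that: 1. $\varrho_n$ is the induced representation: if $R\subset[n]$ contains exactly one point of each orbit of $\Gamma$ on $[n]$ and $\Gamma_i=\{\gamma\in\Gamma:\phi_n(\gamma)(i)=i\}$, then $\varrho_n\cong\bigoplus_{i\in R}\mathrm{Ind}_{\Gamma_i}^{\Gamma}(\rho|_{\Gamma_i})$ as representations of $\Gamma$ (in particular $\varrho_n\cong\mathrm{Ind}_{\Gamma_1}^{\Gamma}(\rho|_{\Gamma_1})$ if $X_n$ is connected and non-empty). 2. For all compact fundamental domains $F$ and $D$ as above, $\Delta_{n,\rho}$ and $\Delta_{\varrho_n}$ have the same spectrum, with the same multiplicities: $\dim\ker(\Delta_{n,\rho}-\lambda)=\dim\ker(\Delta_{\varrho_n}-\lambda)$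 for every $\lambda\in\mathbb C$. 3. For all $\gamma\in\Gamma$, $\mathrm{Tr}\,\varrho_n(\gamma)=\mathrm{Tr}\,\rho(\gamma)\cdot|\mathrm{Fix}(\phi_n(\gamma))|$, where $\mathrm{Fix}(\phi_n(\gamma))\subset[n]$ is the set of fixed points of $\phi_n(\gamma)$. -/

import Mathlib

open MeasureTheory UpperHalfPlane
open scoped MatrixGroups ContDiff

noncomputable section

namespace TwistedLaplacian

/-! ### The group `PSL(2, ℝ)` acting on the hyperbolic plane -/

lemma center_smul (g : SL(2, ℝ)) (hg : g ∈ Subgroup.center SL(2, ℝ)) (z : ℍ) : g • z = z := by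
  obtain ⟨r, hr, hrg⟩ := Matrix.SpecialLinearGroup.mem_center_iff.mp hg
  have hr0 : r ≠ 0 := by
    rintro rfl
    simp at hr
  have h00 : g 0 0 = r := by
    rw [← hrg]; simp
  have h01 : g 0 1 = 0 := by
    rw [← hrg]; simp
  have h10 : g 1 0 = 0 := by
    rw [← hrg]; simp
  have h11 : g 1 1 = r := by
    rw [← hrg]; simp
  apply UpperHalfPlane.ext
  rw [UpperHalfPlane.coe_specialLinearGroup_apply]
  have hrc : (r : ℂ) ≠ 0 := by exact_mod_cast hr0
  simp [h00, h01, h10, h11, hrc]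

/-- The action of `PSL(2, ℝ)` on the upper half-plane by Möbius transformations: the class of
`g ∈ SL(2, ℝ)` acts as `g`. -/
instance instMulActionPSL : MulAction PSL(2, ℝ) ℍ :=
  MulAction.compHom ℍ
    (QuotientGroup.lift (Subgroup.center SL(2, ℝ)) (MulAction.toPermHom SL(2, ℝ) ℍ)
      (fun g hg => Equiv.ext fun z => center_smul g hg z))

lemma mk_smul (g : SL(2, ℝ)) (z : ℍ) : (QuotientGroup.mk g : PSL(2, ℝ)) • z = g • z := rfl

/-- `Γ` is a discrete subgroup of `PSL(2, ℝ)` acting freely on `ℍ` with compact quotient, so that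
`Γ \ ℍ` is a compact hyperbolic surface. -/
structure IsCompactSurfaceGroup (Γ : Subgroup PSL(2, ℝ)) : Prop where
  discrete : DiscreteTopology Γ
  free : ∀ γ : Γ, γ ≠ 1 → ∀ z : ℍ, γ • z ≠ z
  cocompact : CompactSpace (MulAction.orbitRel.Quotient Γ ℍ)

/-! ### Closed operators and their spectra -/

section Operators

variable {E : Type*} [NormedAddCommGroup E] [NormedSpace ℂ E]

/-- The spectrum of an unbounded operator `A`: the set of `c` such that `A - c` does not have a
bounded, everywhere defined, two-sided inverse. -/
def spectrum (A : E →ₗ.[ℂ] E) : Set ℂ :=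
  {c | ¬ ∃ R : E →L[ℂ] E, (∀ u : A.domain, R (A u - c • (u : E)) = u) ∧
    ∀ v : E, ∃ u : A.domain, (u : E) = R v ∧ A u - c • (u : E) = v}

/-- The eigenspace `ker (A - c)` of an unbounded operator. -/
def eigenspace (A : E →ₗ.[ℂ] E) (c : ℂ) : Submodule ℂ A.domain :=
  LinearMap.ker (A.toFun - c • A.domain.subtype)

end Operators

section L2

variable {V : Type*} [NormedAddCommGroup V] [InnerProductSpace ℂ V]
  {M : Type*} [MeasurableSpace M]

/-- The graph in `L²(M, μ; V)` of an operator `L` given on a space `S` of functions `M → V`. -/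
def l2Graph (μ : Measure M) (S : Submodule ℂ (M → V)) (L : S →ₗ[ℂ] (M → V)) :
    Submodule ℂ (Lp V 2 μ × Lp V 2 μ) where
  carrier := {p | ∃ ψ : S, p.1 =ᵐ[μ] (ψ : M → V) ∧ p.2 =ᵐ[μ] L ψ}
  zero_mem' := ⟨0, by simpa using Lp.coeFn_zero V 2 μ, by simpa using Lp.coeFn_zero V 2 μ⟩
  add_mem' := by
    rintro p q ⟨ψ, h₁, h₂⟩ ⟨ξ, k₁, k₂⟩
    refine ⟨ψ + ξ, (Lp.coeFn_add p.1 q.1).trans ?_, (Lp.coeFn_add p.2 q.2).trans ?_⟩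
    · exact h₁.add k₁
    · rw [map_add]
      exact h₂.add k₂
  smul_mem' := by
    rintro c p ⟨ψ, h₁, h₂⟩
    refine ⟨c • ψ, (Lp.coeFn_smul c p.1).trans ?_, (Lp.coeFn_smul c p.2).trans ?_⟩
    · exact h₁.const_smul c
    · rw [map_smul]
      exact h₂.const_smul c

/-- The closure in `L²(M, μ; V)` of an operator `L` given on a space `S` of functions: the
operator whose graph is the closure of the graph of `L`. When `L` is essentially self-adjoint, this
is its unique self-adjoint extension. -/
def l2Closure (μ : Measure M) (S : Submodule ℂ (M → V)) (L : S →ₗ[ℂ] (M → V)) :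
    Lp V 2 μ →ₗ.[ℂ] Lp V 2 μ :=
  (l2Graph μ S L).topologicalClosure.toLinearPMap

end L2

/-! ### The hyperbolic Laplacian -/

section Laplacian

variable {V : Type*} [NormedAddCommGroup V] [InnerProductSpace ℂ V]

/-- Smooth vector-valued functions on the hyperbolic plane. -/
def IsSmooth (ψ : ℍ → V) : Prop :=
  ContDiffOn ℝ ∞ (fun z : ℂ => ψ (ofComplex z)) {z | 0 < z.im}

/-- The (positive) hyperbolic Laplacian `-y² (∂²/∂x² + ∂²/∂y²)`. -/
def hypLaplacian (ψ : ℍ → V) (z : ℍ) : V :=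
  -(z.im ^ 2 • Laplacian.laplacian (fun w : ℂ => ψ (ofComplex w)) (z : ℂ))

lemma IsSmooth.contDiffAt {ψ : ℍ → V} (h : IsSmooth ψ) (z : ℍ) :
    ContDiffAt ℝ 2 (fun w : ℂ => ψ (ofComplex w)) (z : ℂ) :=
  (ContDiffOn.contDiffAt h (isOpen_upperHalfPlaneSet.mem_nhds z.im_pos)).of_le
    (WithTop.coe_le_coe.2 (le_top : (2 : ℕ∞) ≤ ⊤))

lemma IsSmooth.zero : IsSmooth (0 : ℍ → V) := contDiffOn_const

lemma IsSmooth.add {ψ ξ : ℍ → V} (hψ : IsSmooth ψ) (hξ : IsSmooth ξ) : IsSmooth (ψ + ξ) :=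
  ContDiffOn.add hψ hξ

lemma IsSmooth.smul {ψ : ℍ → V} (c : ℂ) (hψ : IsSmooth ψ) : IsSmooth (c • ψ) :=
  ContDiffOn.const_smul c hψ

lemma hypLaplacian_add {ψ ξ : ℍ → V} (hψ : IsSmooth ψ) (hξ : IsSmooth ξ) :
    hypLaplacian (ψ + ξ) = hypLaplacian ψ + hypLaplacian ξ := by
  funext z
  have := (hψ.contDiffAt z).laplacian_add (hξ.contDiffAt z)
  simp only [hypLaplacian, Pi.add_apply]
  rw [← neg_add, ← smul_add]
  exact congrArg (fun v => -(z.im ^ 2 • v)) this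

lemma hypLaplacian_smul {ψ : ℍ → V} (c : ℂ) (hψ : IsSmooth ψ) :
    hypLaplacian (c • ψ) = c • hypLaplacian ψ := by
  funext z
  have := InnerProductSpace.laplacian_smul c (hψ.contDiffAt z)
  simp only [hypLaplacian, Pi.smul_apply]
  rw [smul_neg, smul_comm c]
  exact congrArg (fun v => -(z.im ^ 2 • v)) this

variable {Γ : Subgroup PSL(2, ℝ)}

/-! ### The twisted Laplacian on `X = Γ \ ℍ` -/

/-- The smooth functions `ψ : ℍ → V` with `ψ (γ z) = ρ(γ) ψ(z)` for all `γ ∈ Γ`. -/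
def sections (ρ : Γ →* (V ≃ₗᵢ[ℂ] V)) : Submodule ℂ (ℍ → V) where
  carrier := {ψ | IsSmooth ψ ∧ ∀ (γ : Γ) (z : ℍ), ψ (γ • z) = ρ γ (ψ z)}
  zero_mem' := ⟨IsSmooth.zero, by simp⟩
  add_mem' := fun hψ hξ => ⟨hψ.1.add hξ.1, fun γ z => by simp [hψ.2 γ z, hξ.2 γ z]⟩
  smul_mem' := fun c _ hψ => ⟨hψ.1.smul c, fun γ z => by simp [hψ.2 γ z]⟩

/-- The hyperbolic Laplacian on smooth `ρ`-equivariant functions. -/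
def sectionsLaplacian (ρ : Γ →* (V ≃ₗᵢ[ℂ] V)) : sections ρ →ₗ[ℂ] (ℍ → V) where
  toFun ψ := hypLaplacian (ψ : ℍ → V)
  map_add' ψ ξ := hypLaplacian_add ψ.2.1 ξ.2.1
  map_smul' c ψ := hypLaplacian_smul c ψ.2.1

/-- The twisted Laplacian `Δ_ρ` of `X = Γ \ ℍ`, as a closed operator on `L²(F; V)`, where `F` is a
fundamental domain of `Γ` and `ρ`-equivariant functions are identified with their restrictions
to `F`. -/
def twistedLaplacian (ρ : Γ →* (V ≃ₗᵢ[ℂ] V)) (F : Set ℍ) :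
    Lp V 2 (volume.restrict F) →ₗ.[ℂ] Lp V 2 (volume.restrict F) :=
  l2Closure (volume.restrict F) (sections ρ) (sectionsLaplacian ρ)

/-! ### The twisted Laplacian on the cover `X_n = Γ \ (ℍ × [n])` -/

variable {n : ℕ}

/-- The action `γ (z, j) = (γ z, φ(γ) j)` of `Γ` on `ℍ × [n]`; its quotient is the cover `X_n`. -/
@[reducible]
def coverAction (φ : Γ →* Equiv.Perm (Fin n)) : MulAction Γ (ℍ × Fin n) where
  smul γ p := (γ • p.1, φ γ p.2)
  one_smul p := Prod.ext (one_smul Γ p.1) (by change φ 1 p.2 = p.2; simp)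
  mul_smul a b p := Prod.ext (mul_smul a b p.1) (by
    change φ (a * b) p.2 = φ a (φ b p.2)
    simp)

/-- The hyperbolic area measure of `ℍ × [n]`, a disjoint union of `n` copies of `ℍ`. -/
def coverVolume (n : ℕ) : Measure (ℍ × Fin n) := (volume : Measure ℍ).prod Measure.count

/-- `D` is a fundamental domain of the action of `Γ` on `ℍ × [n]`. -/
def IsCoverFundamentalDomain (φ : Γ →* Equiv.Perm (Fin n)) (D : Set (ℍ × Fin n)) : Prop :=
  letI := coverAction φ
  IsFundamentalDomain Γ D (coverVolume n)

/-- The smooth functions `ψ : ℍ × [n] → V` with `ψ (γ z, φ(γ) j) = ρ(γ) ψ(z, j)` for all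
`γ ∈ Γ`, i.e. the smooth sections over `X_n` of the flat bundle defined by `ρ`. -/
def coverSections (φ : Γ →* Equiv.Perm (Fin n)) (ρ : Γ →* (V ≃ₗᵢ[ℂ] V)) :
    Submodule ℂ (ℍ × Fin n → V) where
  carrier := {ψ | (∀ j, IsSmooth fun z => ψ (z, j)) ∧
    ∀ (γ : Γ) (z : ℍ) (j : Fin n), ψ (γ • z, φ γ j) = ρ γ (ψ (z, j))}
  zero_mem' := ⟨fun _ => IsSmooth.zero, by simp⟩
  add_mem' := fun hψ hξ =>
    ⟨fun j => (hψ.1 j).add (hξ.1 j), fun γ z j => by simp [hψ.2 γ z j, hξ.2 γ z j]⟩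
  smul_mem' := fun c _ hψ => ⟨fun j => (hψ.1 j).smul c, fun γ z j => by simp [hψ.2 γ z j]⟩

/-- The hyperbolic Laplacian on smooth equivariant functions on `ℍ × [n]`, acting on each sheet. -/
def coverSectionsLaplacian (φ : Γ →* Equiv.Perm (Fin n)) (ρ : Γ →* (V ≃ₗᵢ[ℂ] V)) :
    coverSections φ ρ →ₗ[ℂ] (ℍ × Fin n → V) where
  toFun ψ p := hypLaplacian (fun z => (ψ : ℍ × Fin n → V) (z, p.2)) p.1
  map_add' ψ ξ := funext fun p =>
    congrFun (hypLaplacian_add (ψ.2.1 p.2) (ξ.2.1 p.2)) p.1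
  map_smul' c ψ := funext fun p =>
    congrFun (hypLaplacian_smul c (ψ.2.1 p.2)) p.1

/-- The Laplacian `Δ_{n,ρ}` of the cover `X_n = Γ \ (ℍ × [n])` twisted by `ρ`, as a closed operator
on `L²(D; V)`, where `D` is a fundamental domain of `Γ` acting on `ℍ × [n]`. -/
def coverLaplacian (φ : Γ →* Equiv.Perm (Fin n)) (ρ : Γ →* (V ≃ₗᵢ[ℂ] V))
    (D : Set (ℍ × Fin n)) :
    Lp V 2 ((coverVolume n).restrict D) →ₗ.[ℂ] Lp V 2 ((coverVolume n).restrict D) :=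
  l2Closure ((coverVolume n).restrict D) (coverSections φ ρ) (coverSectionsLaplacian φ ρ)

/-! ### Induced representations -/

/-- The linear representation underlying a unitary representation. -/
def toRep {G : Type*} [Group G] (ρ : G →* (V ≃ₗᵢ[ℂ] V)) : Representation ℂ G V where
  toFun g := (ρ g).toLinearEquiv.toLinearMap
  map_one' := by rw [map_one]; rfl
  map_mul' a b := by rw [map_mul]; rfl

/-- The stabilizer in `Γ` of the point `i ∈ [n]`. -/
def stab (φ : Γ →* Equiv.Perm (Fin n)) (i : Fin n) : Subgroup Γ where
  carrier := {γ | φ γ i = i}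
  one_mem' := by simp
  mul_mem' := by
    intro a b (ha : φ a i = i) (hb : φ b i = i)
    change φ (a * b) i = i
    rw [map_mul, Equiv.Perm.mul_apply, hb, ha]
  inv_mem' := by
    intro a (ha : φ a i = i)
    change φ a⁻¹ i = i
    rw [map_inv, Equiv.Perm.inv_eq_iff_eq, ha]

/-- `R` contains exactly one point of each orbit of `Γ` on `[n]`. -/
def IsOrbitTransversal (φ : Γ →* Equiv.Perm (Fin n)) (R : Set (Fin n)) : Prop :=
  ∀ j, ∃! i, i ∈ R ∧ ∃ γ : Γ, φ γ i = j

/-- The direct sum over `i ∈ R` of the representations of `Γ` induced from the restrictions of `ρ`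
to the stabilizers of `i`. For transitive `φ` and `R = {i}` it is the representation induced from
the restriction of `ρ` to the stabilizer of `i`. -/
def inducedRep (φ : Γ →* Equiv.Perm (Fin n)) (ρ : Γ →* (V ≃ₗᵢ[ℂ] V)) (R : Set (Fin n)) :=
  Representation.directSum fun i : R =>
    Representation.ind (stab φ (i : Fin n)).subtype ((toRep ρ).comp (stab φ (i : Fin n)).subtype)

end Laplacian

end TwistedLaplacian

end

-- A function `ψ` on `ℍ × [n]` with values in `V` is the same thing as a function on `ℍ` with values
-- in `Vⁿ` (`curryPi`). Let `γ` act on `Vⁿ` by applying `ρ γ` in each coordinate and permuting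
-- coordinates by `φ γ` (`permRep`). Then equivariance on one side is equivariance on the other, and
-- smoothness and the Laplacian are coordinatewise, so the two spaces of sections and their
-- operators correspond.
--
-- The two `L²` spaces must still be matched, since `D` need not be `F × [n]`. Every `L²` class on a
-- fundamental domain has an equivariant representative, and the norm of an equivariant function
-- does not depend on the domain, because the measure is invariant and the representation unitary.
-- This gives a unitary map `T` (`SameL2.equiv`, `sameL2_cover`). It carries graph to graph once the
-- Laplacian of a section is known to be equivariant (`coverSectionsLaplacian_mem`), which rests on
-- conformal covariance of the planar Laplacian. As `T × T` is a homeomorphism, closures of graphs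
-- correspond too, hence spectra and eigenspaces; no spectral theory or essential self-adjointness
-- is needed.
--
-- The rest is algebra. `Γ` permutes the summands of `Vⁿ` as it permutes `[n]`, so each orbit
-- contributes the representation induced from a stabilizer (`toInducedRep_incl`,
-- `toInducedRep_permRep`), and only the blocks at fixed points contribute to the trace.

universe u

noncomputable section

namespace TwistedLaplacian

/-! ### Transport of unbounded operators along continuous linear equivalences -/

section Transport

variable {E E' : Type*} [NormedAddCommGroup E] [NormedSpace ℂ E]
  [NormedAddCommGroup E'] [NormedSpace ℂ E']

/-- `T` carries the unbounded operator `A` to the unbounded operator `A'`. -/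
structure Intertwines (T : E ≃L[ℂ] E') (A : E →ₗ.[ℂ] E) (A' : E' →ₗ.[ℂ] E') : Prop where
  mem_domain_iff : ∀ x, T x ∈ A'.domain ↔ x ∈ A.domain
  map_apply : ∀ (x : A.domain) (y : A'.domain), (y : E') = T x → A' y = T (A x)

namespace Intertwines

variable {T : E ≃L[ℂ] E'} {A : E →ₗ.[ℂ] E} {A' : E' →ₗ.[ℂ] E'}

lemma symm (h : Intertwines T A A') : Intertwines T.symm A' A where
  mem_domain_iff x := by rw [← h.mem_domain_iff, T.apply_symm_apply]
  map_apply x y hxy := by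
    rw [h.map_apply y x (by rw [hxy, T.apply_symm_apply]), T.symm_apply_apply]

lemma spectrum_subset (h : Intertwines T A A') : spectrum A' ⊆ spectrum A := by
  rintro c hc ⟨R, h₁, h₂⟩
  refine hc ⟨(T : E →L[ℂ] E') ∘L R ∘L (T.symm : E' →L[ℂ] E), fun u => ?_, fun v => ?_⟩
  · have hu : T.symm u ∈ A.domain := (h.symm.mem_domain_iff u).2 u.2
    have := h₁ ⟨T.symm u, hu⟩
    rw [h.symm.map_apply u ⟨T.symm u, hu⟩ rfl] at this
    simp only [ContinuousLinearMap.comp_apply, ContinuousLinearEquiv.coe_coe, map_sub, map_smul]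
    simp only [map_sub, map_smul] at this
    rw [← map_smul, ← map_sub, this, T.apply_symm_apply]
  · obtain ⟨u, hu, huv⟩ := h₂ (T.symm v)
    refine ⟨⟨T u, (h.mem_domain_iff u).2 u.2⟩, by simp [hu], ?_⟩
    rw [h.map_apply u ⟨T u, _⟩ rfl]
    simp only
    rw [← map_smul, ← map_sub, huv, T.apply_symm_apply]

lemma spectrum_eq (h : Intertwines T A A') : spectrum A = spectrum A' :=
  h.symm.spectrum_subset.antisymm h.spectrum_subset

lemma mem_eigenspace_iff (A : E →ₗ.[ℂ] E) (c : ℂ) (x : A.domain) :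
    x ∈ eigenspace A c ↔ A x = c • (x : E) := by
  rw [eigenspace, LinearMap.mem_ker, LinearMap.sub_apply, sub_eq_zero]
  rfl

/-- The linear equivalence of domains given by an intertwiner. -/
def domainEquiv (h : Intertwines T A A') : A.domain ≃ₗ[ℂ] A'.domain where
  toFun x := ⟨T x, (h.mem_domain_iff x).2 x.2⟩
  invFun y := ⟨T.symm y, (h.symm.mem_domain_iff y).2 y.2⟩
  map_add' x y := by ext; simp
  map_smul' c x := by ext; simp
  left_inv x := by simp
  right_inv x := by simp

lemma map_eigenspace (h : Intertwines T A A') (c : ℂ) :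
    (eigenspace A c).map (h.domainEquiv : A.domain →ₗ[ℂ] A'.domain) = eigenspace A' c := by
  ext y
  obtain ⟨x, rfl⟩ := h.domainEquiv.surjective y
  have hx : A' (h.domainEquiv x) = T (A x) := h.map_apply x _ rfl
  have hx' : ((h.domainEquiv x : A'.domain) : E') = T x := rfl
  rw [Submodule.mem_map_equiv, LinearEquiv.symm_apply_apply, mem_eigenspace_iff,
    mem_eigenspace_iff, hx, hx', ← map_smul, T.injective.eq_iff]

end Intertwines

/-- The common universe makes the two cardinals comparable by an equality. -/
lemma Intertwines.rank_eigenspace_eq {E E' : Type u} [NormedAddCommGroup E] [NormedSpace ℂ E]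
    [NormedAddCommGroup E'] [NormedSpace ℂ E'] {T : E ≃L[ℂ] E'} {A : E →ₗ.[ℂ] E}
    {A' : E' →ₗ.[ℂ] E'} (h : Intertwines T A A') (c : ℂ) :
    Module.rank ℂ (eigenspace A c) = Module.rank ℂ (eigenspace A' c) := by
  rw [← h.map_eigenspace c]
  exact (h.domainEquiv.submoduleMap (eigenspace A c)).rank_eq

/-- If the relation is not single-valued, `toLinearPMap` takes the default value zero on its domain.
Treating this case as well spares a proof of closability: intertwining holds either way. -/
lemma toLinearPMap_apply_of_not {g : Submodule ℂ (E × E)}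
    (hg : ¬ ∀ x ∈ g, x.1 = 0 → x.2 = 0) (x : g.toLinearPMap.domain) :
    g.toLinearPMap x = 0 := by
  classical
  change (if hg : _ then g.toLinearPMapAux hg else 0) x = _
  rw [dif_neg hg]
  rfl

lemma intertwines_toLinearPMap {T : E ≃L[ℂ] E'} {g : Submodule ℂ (E × E)}
    {g' : Submodule ℂ (E' × E')} (h : ∀ x y, (T x, T y) ∈ g' ↔ (x, y) ∈ g) :
    Intertwines T g.toLinearPMap g'.toLinearPMap where
  mem_domain_iff x := by
    simp only [Submodule.toLinearPMap_domain, Submodule.mem_map, LinearMap.fst_apply, Prod.exists,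
      exists_and_right, exists_eq_right]
    rw [T.surjective.exists]
    simp only [h]
  map_apply x y hxy := by
    by_cases hg : ∀ x ∈ g, x.1 = 0 → x.2 = 0
    · have hg' : ∀ x ∈ g', x.1 = 0 → x.2 = 0 := by
        rintro ⟨a, b⟩ hab (rfl : a = 0)
        obtain ⟨b, rfl⟩ := T.surjective b
        rw [← map_zero T, h] at hab
        change T b = 0
        rw [show b = 0 from hg _ hab rfl, map_zero]
      have hy := g'.mem_graph_toLinearPMap hg' y
      have hx := (h _ _).2 (g.mem_graph_toLinearPMap hg x)
      have := hg' _ (g'.sub_mem hy hx) (by simp [hxy])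
      exact sub_eq_zero.1 this
    · have hg' : ¬ ∀ x ∈ g', x.1 = 0 → x.2 = 0 := fun hg' => hg <| by
        rintro ⟨a, b⟩ hab (rfl : a = 0)
        have := hg' _ ((h _ _).2 hab) (map_zero T)
        exact T.map_eq_zero_iff.1 this
      rw [toLinearPMap_apply_of_not hg, toLinearPMap_apply_of_not hg', map_zero]

/-- `T × T` is a homeomorphism, so taking preimages under it commutes with closure. -/
lemma mem_topologicalClosure_prod_iff {T : E ≃L[ℂ] E'} {g : Submodule ℂ (E × E)}
    {g' : Submodule ℂ (E' × E')} (h : ∀ x y, (T x, T y) ∈ g' ↔ (x, y) ∈ g) (x y : E) :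
    (T x, T y) ∈ g'.topologicalClosure ↔ (x, y) ∈ g.topologicalClosure := by
  have hg : (g : Set (E × E)) = (T.prodCongr T) ⁻¹' (g' : Set (E' × E')) := by
    ext ⟨a, b⟩
    exact (h a b).symm
  rw [← SetLike.mem_coe, ← SetLike.mem_coe, Submodule.topologicalClosure_coe,
    Submodule.topologicalClosure_coe, hg]
  change _ ↔ _ ∈ closure ((T.prodCongr T).toHomeomorph ⁻¹' (g' : Set (E' × E')))
  rw [← Homeomorph.preimage_closure]
  rfl

end Transport

/-! ### `L²` spaces described by spaces of functions -/

section L2Equiv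

variable {P V W M N : Type*} [AddCommGroup P] [Module ℂ P]
  [NormedAddCommGroup V] [InnerProductSpace ℂ V] [NormedAddCommGroup W] [InnerProductSpace ℂ W]
  [MeasurableSpace M] [MeasurableSpace N] {μ : Measure M} {ν : Measure N}

/-- Two linear maps from a space of parameters to functions on measure spaces have the same
`L²` seminorms. -/
structure SameL2 (a : P →ₗ[ℂ] (M → V)) (b : P →ₗ[ℂ] (N → W)) (μ : Measure M) (ν : Measure N) :
    Prop where
  aestronglyMeasurable_iff : ∀ f, AEStronglyMeasurable (a f) μ ↔ AEStronglyMeasurable (b f) ν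
  eLpNorm_eq : ∀ f, AEStronglyMeasurable (a f) μ → eLpNorm (a f) 2 μ = eLpNorm (b f) 2 ν

namespace SameL2

variable {a : P →ₗ[ℂ] (M → V)} {b : P →ₗ[ℂ] (N → W)}

lemma symm (h : SameL2 a b μ ν) : SameL2 b a ν μ :=
  ⟨fun f => (h.1 f).symm, fun f hf => (h.2 f ((h.1 f).2 hf)).symm⟩

lemma memLp (h : SameL2 a b μ ν) {f : P} (hf : MemLp (a f) 2 μ) : MemLp (b f) 2 ν :=
  ⟨(h.1 f).1 hf.1, h.2 f hf.1 ▸ hf.2⟩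

/-- By linearity it suffices that a null function goes to a null function, and this is equality of
seminorms applied to `f - f'`. It makes `map` well defined. -/
lemma ae_eq (h : SameL2 a b μ ν) {f f' : P} (hf : a f =ᵐ[μ] a f') : b f =ᵐ[ν] b f' := by
  have h₀ : a (f - f') =ᵐ[μ] 0 := by
    rw [map_sub]
    filter_upwards [hf] with x hx
    simp [hx]
  have h₁ : AEStronglyMeasurable (a (f - f')) μ := aestronglyMeasurable_zero.congr h₀.symm
  have h₂ : eLpNorm (b (f - f')) 2 ν = 0 := by
    rw [← h.eLpNorm_eq _ h₁, eLpNorm_congr_ae h₀, eLpNorm_zero]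
  have h₃ := (eLpNorm_eq_zero_iff ((h.aestronglyMeasurable_iff _).1 h₁) two_ne_zero).1 h₂
  rw [map_sub] at h₃
  filter_upwards [h₃] with x hx
  exact sub_eq_zero.1 hx

lemma exists_ae_eq (h : SameL2 a b μ ν) {u : Lp V 2 μ} {f : P} (hf : u =ᵐ[μ] a f) :
    ∃ w : Lp W 2 ν, w =ᵐ[ν] b f :=
  have hf' : MemLp (b f) 2 ν := h.memLp ((memLp_congr_ae hf).1 (Lp.memLp u))
  ⟨hf'.toLp, hf'.coeFn_toLp⟩

lemma exists_image (h : SameL2 a b μ ν) (ha : ∀ u : Lp V 2 μ, ∃ f, u =ᵐ[μ] a f) (u : Lp V 2 μ) :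
    ∃ w : Lp W 2 ν, ∀ f, u =ᵐ[μ] a f → w =ᵐ[ν] b f := by
  obtain ⟨f, hf⟩ := ha u
  obtain ⟨w, hw⟩ := h.exists_ae_eq hf
  exact ⟨w, fun f' hf' => hw.trans (h.ae_eq (hf.symm.trans hf'))⟩

/-- The map `L²(M; V) → L²(N; W)` sending the class of `a f` to the class of `b f`. -/
def map (h : SameL2 a b μ ν) (ha : ∀ u : Lp V 2 μ, ∃ f, u =ᵐ[μ] a f) (u : Lp V 2 μ) :
    Lp W 2 ν :=
  (h.exists_image ha u).choose

lemma map_ae_eq (h : SameL2 a b μ ν) (ha : ∀ u : Lp V 2 μ, ∃ f, u =ᵐ[μ] a f) {u : Lp V 2 μ}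
    {f : P} (hf : u =ᵐ[μ] a f) : h.map ha u =ᵐ[ν] b f :=
  (h.exists_image ha u).choose_spec f hf

/-- The isometric isomorphism `L²(M; V) ≃ L²(N; W)` sending the class of `a f` to the class
of `b f`. -/
def equiv (h : SameL2 a b μ ν) (ha : ∀ u : Lp V 2 μ, ∃ f, u =ᵐ[μ] a f)
    (hb : ∀ w : Lp W 2 ν, ∃ f, w =ᵐ[ν] b f) : Lp V 2 μ ≃ₗᵢ[ℂ] Lp W 2 ν where
  toFun := h.map ha
  invFun := h.symm.map hb
  map_add' u v := by
    obtain ⟨f, hf⟩ := ha u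
    obtain ⟨g, hg⟩ := ha v
    refine Lp.ext ((h.map_ae_eq ha (f := f + g) ?_).trans ?_)
    · rw [map_add]
      exact (Lp.coeFn_add u v).trans (hf.add hg)
    · rw [map_add]
      exact ((Lp.coeFn_add _ _).trans ((h.map_ae_eq ha hf).add (h.map_ae_eq ha hg))).symm
  map_smul' c u := by
    obtain ⟨f, hf⟩ := ha u
    refine Lp.ext ((h.map_ae_eq ha (f := c • f) ?_).trans ?_)
    · rw [map_smul]
      exact (Lp.coeFn_smul c u).trans (hf.const_smul c)
    · rw [map_smul]
      exact ((Lp.coeFn_smul c _).trans ((h.map_ae_eq ha hf).const_smul c)).symm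
  left_inv u := by
    obtain ⟨f, hf⟩ := ha u
    exact Lp.ext ((h.symm.map_ae_eq hb (h.map_ae_eq ha hf)).trans hf.symm)
  right_inv w := by
    obtain ⟨f, hf⟩ := hb w
    exact Lp.ext ((h.map_ae_eq ha (h.symm.map_ae_eq hb hf)).trans hf.symm)
  norm_map' u := by
    obtain ⟨f, hf⟩ := ha u
    change ‖h.map ha u‖ = ‖u‖
    rw [Lp.norm_def, Lp.norm_def, eLpNorm_congr_ae hf, eLpNorm_congr_ae (h.map_ae_eq ha hf),
      h.eLpNorm_eq _ ((Lp.aestronglyMeasurable u).congr hf)]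

/-- This turns membership in an `l2Graph` on one side into membership on the other. -/
lemma equiv_ae_eq_iff (h : SameL2 a b μ ν) (ha : ∀ u : Lp V 2 μ, ∃ f, u =ᵐ[μ] a f)
    (hb : ∀ w : Lp W 2 ν, ∃ f, w =ᵐ[ν] b f) (u : Lp V 2 μ) (f : P) :
    h.equiv ha hb u =ᵐ[ν] b f ↔ u =ᵐ[μ] a f := by
  refine ⟨fun hu => ?_, h.map_ae_eq ha⟩
  rw [← (h.equiv ha hb).symm_apply_apply u]
  exact h.symm.map_ae_eq hb hu

end SameL2

end L2Equiv

/-! ### Equivariant functions and fundamental domains -/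

section Equivariant

variable {G M W : Type*} [Group G] [MulAction G M] [NormedAddCommGroup W] [InnerProductSpace ℂ W]
  {s t : Set M}

/-- The functions `f : M → W` with `f (g • x) = ϱ(g) f(x)`. -/
def equivariantFunctions (M : Type*) [MulAction G M] (ϱ : G →* (W ≃ₗᵢ[ℂ] W)) :
    Submodule ℂ (M → W) where
  carrier := {f | ∀ (g : G) (x : M), f (g • x) = ϱ g (f x)}
  zero_mem' := by simp
  add_mem' := fun hf hf' g x => by simp [hf g x, hf' g x]
  smul_mem' := fun c _ hf g x => by simp [hf g x]

/-- The equivariant function that agrees with `f` at the points of `s` that are alone in `s` in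
their orbit. -/
def equivariantExtension (ϱ : G →* (W ≃ₗᵢ[ℂ] W)) (s : Set M) (f : M → W) (x : M) : W :=
  open Classical in
  if h : ∃! g : G, g • x ∈ s then ϱ h.choose⁻¹ (f (h.choose • x)) else 0

lemma equivariantExtension_apply (ϱ : G →* (W ≃ₗᵢ[ℂ] W)) (f : M → W) {x : M}
    (h : ∃! g : G, g • x ∈ s) {g : G} (hg : g • x ∈ s) :
    equivariantExtension ϱ s f x = ϱ g⁻¹ (f (g • x)) := by
  rw [equivariantExtension, dif_pos h, h.unique h.choose_spec.1 hg]

/-- Right multiplication by `g` is a bijection between the two sets of solutions `k`. -/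
lemma existsUnique_smul_smul_mem_iff (g : G) (x : M) :
    (∃! k : G, k • g • x ∈ s) ↔ ∃! k : G, k • x ∈ s :=
  (Equiv.mulRight g).existsUnique_congr fun k => by simp [mul_smul]

lemma equivariantExtension_mem (ϱ : G →* (W ≃ₗᵢ[ℂ] W)) (s : Set M) (f : M → W) :
    equivariantExtension ϱ s f ∈ equivariantFunctions M ϱ := by
  intro g x
  by_cases h : ∃! k : G, k • x ∈ s
  · obtain ⟨k, hk⟩ := h.exists
    rw [equivariantExtension_apply ϱ f h hk,
      equivariantExtension_apply ϱ f ((existsUnique_smul_smul_mem_iff g x).2 h) (g := k * g⁻¹)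
      (by rwa [mul_smul, inv_smul_smul]), mul_smul, inv_smul_smul, mul_inv_rev, inv_inv, map_mul]
    rfl
  · have h' := mt (existsUnique_smul_smul_mem_iff g x).1 h
    rw [equivariantExtension, equivariantExtension, dif_neg h, dif_neg h', map_zero]

variable [MeasurableSpace M] {μ : Measure M}

/-- Distinct translates of `s` overlap in null sets and `G` is countable, so almost every point of
`s` is the only point of its orbit in `s`, reached only by `g = 1`. -/
lemma equivariantExtension_ae_eq [Countable G] (hs : IsFundamentalDomain G s μ)
    (hsm : MeasurableSet s) (ϱ : G →* (W ≃ₗᵢ[ℂ] W)) (f : M → W) :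
    equivariantExtension ϱ s f =ᵐ[μ.restrict s] f := by
  have h : ∀ᵐ x ∂μ, ∀ g : G, g ≠ 1 → x ∈ s → g • x ∉ s := by
    rw [ae_all_iff]
    intro g
    by_cases hg : g = 1
    · simp [hg]
    have := hs.aedisjoint (inv_ne_one.2 hg)
    filter_upwards [measure_eq_zero_iff_ae_notMem.1 this] with x hx _ hxs hgx
    -- A point with `x` and `g • x` both in `s` lies in the null set `g⁻¹ • s ∩ 1 • s`.
    exact hx ⟨Set.mem_inv_smul_set_iff.2 hgx, x, hxs, one_smul G x⟩
  rw [Filter.EventuallyEq, ae_restrict_iff' hsm]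
  filter_upwards [h] with x hx hxs
  have hx1 : (1 : G) • x ∈ s := by rwa [one_smul]
  rw [equivariantExtension_apply ϱ f ⟨1, hx1, fun g hg => ?_⟩ hx1]
  · simp
  · by_contra hg1
    exact hx g hg1 hxs hg

lemma exists_equivariant_ae_eq [Countable G] (hs : IsFundamentalDomain G s μ)
    (hsm : MeasurableSet s) (ϱ : G →* (W ≃ₗᵢ[ℂ] W)) (f : M → W) :
    ∃ f' ∈ equivariantFunctions M ϱ, f =ᵐ[μ.restrict s] f' :=
  ⟨_, equivariantExtension_mem ϱ s f, (equivariantExtension_ae_eq hs hsm ϱ f).symm⟩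

variable [Countable G] [MeasurableConstSMul G M] [SMulInvariantMeasure G M μ]

/-- The translates `g • s` exhaust `μ`, and on `g • s` the function is `ϱ g ∘ f` transported from
`s`. Two fundamental domains are then compared through the whole space. -/
lemma aestronglyMeasurable_of_equivariant (hs : IsFundamentalDomain G s μ)
    {ϱ : G →* (W ≃ₗᵢ[ℂ] W)} {f : M → W} (hf : f ∈ equivariantFunctions M ϱ)
    (h : AEStronglyMeasurable f (μ.restrict s)) : AEStronglyMeasurable f μ := by
  rw [← hs.sum_restrict, aestronglyMeasurable_sum_measure_iff]
  intro g
  have he : MeasurableEmbedding (g • · : M → M) := measurableEmbedding_const_smul _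
  rw [← Set.image_smul, ← ((measurePreserving_smul g μ).restrict_image_emb he
    _).aestronglyMeasurable_comp_iff he]
  have : f ∘ (g • ·) = fun x => ϱ g (f x) := funext (hf g)
  rw [this]
  exact (ϱ g).continuous.comp_aestronglyMeasurable h

lemma aestronglyMeasurable_restrict_iff_of_equivariant (hs : IsFundamentalDomain G s μ)
    (ht : IsFundamentalDomain G t μ) {ϱ : G →* (W ≃ₗᵢ[ℂ] W)} {f : M → W}
    (hf : f ∈ equivariantFunctions M ϱ) :
    AEStronglyMeasurable f (μ.restrict s) ↔ AEStronglyMeasurable f (μ.restrict t) :=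
  ⟨fun h => (aestronglyMeasurable_of_equivariant hs hf h).restrict,
    fun h => (aestronglyMeasurable_of_equivariant ht hf h).restrict⟩

lemma eLpNorm_restrict_eq_of_equivariant (hs : IsFundamentalDomain G s μ)
    (ht : IsFundamentalDomain G t μ) {ϱ : G →* (W ≃ₗᵢ[ℂ] W)} {f : M → W}
    (hf : f ∈ equivariantFunctions M ϱ) :
    eLpNorm f 2 (μ.restrict s) = eLpNorm f 2 (μ.restrict t) := by
  simp only [eLpNorm_eq_lintegral_rpow_enorm_toReal two_ne_zero ENNReal.ofNat_ne_top]
  rw [hs.setLIntegral_eq ht]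
  intro g x
  rw [hf g x, LinearIsometryEquiv.enorm_map]

end Equivariant

/-! ### Functions on `M × [n]` as functions on `M` with values in `Vⁿ` -/

section Curry

variable {M V : Type*} [NormedAddCommGroup V] {n : ℕ}

section

variable [InnerProductSpace ℂ V]

/-- A function `M × [n] → V` as a function `M → Vⁿ`. -/
def curryPi : (M × Fin n → V) →ₗ[ℂ] (M → PiLp 2 (fun _ : Fin n => V)) where
  toFun f x := WithLp.toLp 2 fun j => f (x, j)
  map_add' _ _ := rfl
  map_smul' _ _ := rfl

@[simp]
lemma curryPi_apply (f : M × Fin n → V) (x : M) (j : Fin n) : curryPi f x j = f (x, j) := rfl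

end

variable [MeasurableSpace M] {μ : Measure M} [SFinite μ]

lemma enorm_sq_eq_sum (v : PiLp 2 (fun _ : Fin n => V)) :
    ‖v‖ₑ ^ (2 : ℝ) = ∑ j, ‖v j‖ₑ ^ (2 : ℝ) := by
  have h : ‖v‖₊ ^ 2 = ∑ j, ‖v j‖₊ ^ 2 := by
    ext
    push_cast
    exact PiLp.norm_sq_eq_of_L2 _ v
  simp only [ENNReal.rpow_ofNat, enorm_eq_nnnorm]
  exact_mod_cast congrArg ((↑) : NNReal → ENNReal) h

lemma prod_count_eq_sum (μ : Measure M) [SFinite μ] :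
    μ.prod (Measure.count : Measure (Fin n)) = Measure.sum fun j => μ.map fun x => (x, j) := by
  rw [Measure.count, Measure.prod_sum_right]
  simp [Measure.prod_dirac]

lemma aestronglyMeasurable_prod_count_iff (f : M × Fin n → V) :
    AEStronglyMeasurable f (μ.prod Measure.count) ↔
      ∀ j, AEStronglyMeasurable (fun x => f (x, j)) μ := by
  rw [prod_count_eq_sum, aestronglyMeasurable_sum_measure_iff]
  exact forall_congr' fun j =>
    (measurableEmbedding_prod_mk_right j).aestronglyMeasurable_map_iff

variable [InnerProductSpace ℂ V]

lemma aestronglyMeasurable_curryPi_iff (f : M × Fin n → V) :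
    AEStronglyMeasurable f (μ.prod Measure.count) ↔ AEStronglyMeasurable (curryPi f) μ := by
  rw [aestronglyMeasurable_prod_count_iff]
  refine ⟨fun h => ?_, fun h j => ?_⟩
  · have hsum : curryPi f = fun x => ∑ j, WithLp.toLp 2 (Pi.single j (f (x, j))) := by
      funext x
      ext i
      simp [Pi.single_apply]
    rw [hsum]
    exact Finset.aestronglyMeasurable_fun_sum _ fun j _ =>
      ((PiLp.continuous_toLp 2 _).comp (continuous_single j)).comp_aestronglyMeasurable (h j)
  · have : Continuous fun v : PiLp 2 (fun _ : Fin n => V) => v j :=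
      (continuous_apply j).comp (PiLp.continuous_ofLp 2 _)
    exact this.comp_aestronglyMeasurable h

lemma eLpNorm_curryPi (f : M × Fin n → V) (hf : AEStronglyMeasurable f (μ.prod Measure.count)) :
    eLpNorm f 2 (μ.prod Measure.count) = eLpNorm (curryPi f) 2 μ := by
  rw [aestronglyMeasurable_prod_count_iff] at hf
  simp only [eLpNorm_eq_lintegral_rpow_enorm_toReal two_ne_zero ENNReal.ofNat_ne_top,
    ENNReal.toReal_ofNat, enorm_sq_eq_sum, curryPi_apply]
  rw [prod_count_eq_sum, lintegral_sum_measure, tsum_fintype,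
    lintegral_finsetSum' _ fun j _ => (hf j).enorm.pow_const 2]
  simp_rw [(measurableEmbedding_prod_mk_right _).lintegral_map]

end Curry

/-! ### Invariance of the hyperbolic Laplacian -/

section Invariance

variable {V : Type*} [NormedAddCommGroup V] [NormedSpace ℝ V]

/-- The second derivative of `f ∘ g` for holomorphic `g`. -/
lemma iteratedFDeriv_two_comp_holomorphic {f : ℂ → V} {g : ℂ → ℂ} {z : ℂ}
    (hf : ContDiffAt ℝ 2 f (g z)) (hg : AnalyticAt ℂ g z) (v : ℂ) :
    iteratedFDeriv ℝ 2 (f ∘ g) z ![v, v] =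
      iteratedFDeriv ℝ 2 f (g z) ![deriv g z * v, deriv g z * v] +
        fderiv ℝ f (g z) (deriv (deriv g) z * v * v) := by
  have hgd {w : ℂ} (hw : AnalyticAt ℂ g w) : HasFDerivAt g
      ((ContinuousLinearMap.toSpanSingleton ℂ (deriv g w)).restrictScalars ℝ) w :=
    hw.differentiableAt.hasDerivAt.hasFDerivAt.restrictScalars ℝ
  have hg2 : HasFDerivAt (deriv g)
      ((ContinuousLinearMap.toSpanSingleton ℂ (deriv (deriv g) z)).restrictScalars ℝ) z :=
    hg.deriv.differentiableAt.hasDerivAt.hasFDerivAt.restrictScalars ℝ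
  have hf2 : HasFDerivAt (fderiv ℝ f) (fderiv ℝ (fderiv ℝ f) (g z)) (g z) :=
    ((hf.fderiv_right (m := 1) le_rfl).differentiableAt one_ne_zero).hasFDerivAt
  have hfd : ∀ᶠ w in nhds z, DifferentiableAt ℝ f (g w) := by
    refine hg.continuousAt.eventually ?_
    filter_upwards [hf.eventually (by simp)] with w hw
    exact hw.differentiableAt two_ne_zero
  have hfg : ContDiffAt ℝ 2 (f ∘ g) z :=
    hf.comp z (hg.contDiffAt.restrict_scalars ℝ)
  have hfg2 : HasFDerivAt (fderiv ℝ (f ∘ g)) (fderiv ℝ (fderiv ℝ (f ∘ g)) z) z :=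
    ((hfg.fderiv_right (m := 1) le_rfl).differentiableAt one_ne_zero).hasFDerivAt
  have h₁ := hfg2.clm_apply (hasFDerivAt_const v z)
  have h₂ := (hf2.comp z (hgd hg)).clm_apply (hg2.mul_const' v)
  -- The chain rule near `z`. Differentiating its two sides by `h₁` and `h₂` and using uniqueness of
  -- the derivative gives the formula.
  have h₃ : (fun w => fderiv ℝ (f ∘ g) w v) =ᶠ[nhds z]
      fun w => (fderiv ℝ f ∘ g) w (deriv g w * v) := by
    filter_upwards [hfd, hg.eventually_analyticAt] with w hw hgw
    rw [(hw.hasFDerivAt.comp w (hgd hgw)).fderiv]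
    simp [mul_comm]
  have h₄ := congrArg (fun L => L v) (h₁.unique (h₂.congr_of_eventuallyEq h₃))
  simp only [iteratedFDeriv_two_apply, Matrix.cons_val_zero, Matrix.cons_val_one]
  simp only [ContinuousLinearMap.comp_zero, zero_add, ContinuousLinearMap.flip_apply,
    _root_.add_apply, _root_.smul_apply, ContinuousLinearMap.comp_apply, Function.comp_apply,
    ContinuousLinearMap.coe_restrictScalars', ContinuousLinearMap.toSpanSingleton_apply,
    smul_eq_mul, op_smul_eq_mul] at h₄
  rw [h₄, add_comm, mul_comm v (deriv g z), mul_comm v (deriv (deriv g) z)]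

/-- Multiplication by `a` is a rotation times a dilation: expanding in the basis `1, I`, the mixed
terms cancel, even for non-symmetric `B`. -/
lemma bilinear_conformal (B : ℂ →L[ℝ] ℂ →L[ℝ] V) (a : ℂ) :
    B a a + B (a * Complex.I) (a * Complex.I) =
      ‖a‖ ^ 2 • (B 1 1 + B Complex.I Complex.I) := by
  have h₁ : a = a.re • (1 : ℂ) + a.im • Complex.I := by simp
  have h₂ : a * Complex.I = (-a.im) • (1 : ℂ) + a.re • Complex.I := by
    apply Complex.ext <;> simp
  rw [h₂, ← Complex.normSq_eq_norm_sq, Complex.normSq_apply]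
  nth_rewrite 1 2 [h₁]
  simp only [map_add, map_smul, _root_.add_apply, _root_.smul_apply]
  module

/-- The Laplacian is conformally covariant in dimension two. -/
lemma laplacian_comp_holomorphic {f : ℂ → V} {g : ℂ → ℂ} {z : ℂ}
    (hf : ContDiffAt ℝ 2 f (g z)) (hg : AnalyticAt ℂ g z) :
    Laplacian.laplacian (f ∘ g) z = ‖deriv g z‖ ^ 2 • Laplacian.laplacian f (g z) := by
  have h := bilinear_conformal (fderiv ℝ (fderiv ℝ f) (g z)) (deriv g z)
  rw [InnerProductSpace.laplacian_eq_iteratedFDeriv_complexPlane,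
    InnerProductSpace.laplacian_eq_iteratedFDeriv_complexPlane]
  simp only [iteratedFDeriv_two_comp_holomorphic hf hg]
  simp only [iteratedFDeriv_two_apply, Matrix.cons_val_zero, Matrix.cons_val_one] at h ⊢
  -- The first-order terms from directions `1` and `I` are `Df(g'')` and `Df(-g'')`, so they cancel.
  rw [← h, mul_one, mul_one, mul_one, mul_assoc, Complex.I_mul_I, mul_neg_one, map_neg]
  abel

end Invariance

section

variable {V : Type*} [NormedAddCommGroup V] [InnerProductSpace ℂ V]

/-- With `g' = (cz + d)⁻²` and `Im (g z) = Im z / |cz + d|²`, the conformal factor `|g'|²` is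
exactly absorbed by the weight `y²`. -/
lemma hypLaplacian_comp_smul_SL {ψ : ℍ → V} (hψ : IsSmooth ψ) (g : SL(2, ℝ)) (z : ℍ) :
    hypLaplacian (fun w => ψ (g • w)) z = hypLaplacian ψ (g • z) := by
  set G : GL (Fin 2) ℝ := Matrix.SpecialLinearGroup.mapGL ℝ g with hG
  have hdet : G.val.det = 1 := by simp [hG]
  have hpos : 0 < G.val.det := hdet ▸ one_pos
  have hgG (w : ℍ) : g • w = G • w := rfl
  have hcomp : (fun w : ℂ => ψ (g • ofComplex w)) =
      (fun w : ℂ => ψ (ofComplex w)) ∘ fun w : ℂ => ((G • ofComplex w : ℍ) : ℂ) := by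
    funext w
    simp [hgG]
  have hz : ((G • ofComplex (z : ℂ) : ℍ) : ℂ) = ((g • z : ℍ) : ℂ) := by simp [hgG]
  have hc : ContDiffAt ℝ 2 (fun w : ℂ => ψ (ofComplex w)) ((G • ofComplex (z : ℂ) : ℍ) : ℂ) :=
    hz ▸ hψ.contDiffAt (g • z)
  rw [hypLaplacian, hypLaplacian, hcomp,
    laplacian_comp_holomorphic (g := fun w : ℂ => ((G • ofComplex w : ℍ) : ℂ)) hc
      (UpperHalfPlane.analyticAt_smul hpos z),
    UpperHalfPlane.deriv_smul hpos, hz, smul_smul, hgG, UpperHalfPlane.im_smul_eq_div_normSq]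
  have hd : G.det.val = 1 := hdet
  rw [hd, hdet, Complex.normSq_eq_norm_sq]
  have h0 : ‖denom G z‖ ≠ 0 := norm_ne_zero_iff.2 (denom_ne_zero G z)
  congr 2
  simp only [Complex.ofReal_one, norm_div, norm_pow, norm_one, abs_one]
  field_simp

lemma hypLaplacian_comp_smul {ψ : ℍ → V} (hψ : IsSmooth ψ) (g : PSL(2, ℝ)) (z : ℍ) :
    hypLaplacian (fun w => ψ (g • w)) z = hypLaplacian ψ (g • z) := by
  induction g using QuotientGroup.induction_on with
  | H g => exact hypLaplacian_comp_smul_SL hψ g z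

lemma hypLaplacian_clm_comp {W : Type*} [NormedAddCommGroup W] [InnerProductSpace ℂ W]
    {ψ : ℍ → V} (hψ : IsSmooth ψ) (L : V →L[ℂ] W) (z : ℍ) :
    hypLaplacian (fun w => L (ψ w)) z = L (hypLaplacian ψ z) := by
  have h := (hψ.contDiffAt z).laplacian_CLM_comp_left (l := L.restrictScalars ℝ)
  rw [hypLaplacian, hypLaplacian, map_neg]
  have hs (r : ℝ) (v : V) : L (r • v) = r • L v := (L.restrictScalars ℝ).map_smul r v
  rw [hs]
  exact congrArg (fun v => -(z.im ^ 2 • v)) h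

end

/-! ### Measure-theoretic properties of the action of `PSL(2, ℝ)` -/

instance : MeasurableConstSMul PSL(2, ℝ) ℍ where
  measurable_const_smul g := by
    induction g using QuotientGroup.induction_on with
    | H g => exact (continuous_const_smul g : Continuous fun z : ℍ => g • z).measurable

instance : SMulInvariantMeasure PSL(2, ℝ) ℍ volume where
  measure_preimage_smul g s hs := by
    induction g using QuotientGroup.induction_on with
    | H g =>
      exact SMulInvariantMeasure.measure_preimage_smul (μ := (volume : Measure ℍ))
        (Matrix.SpecialLinearGroup.mapGL ℝ g) hs

instance : SecondCountableTopology PSL(2, ℝ) := by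
  have : SecondCountableTopology SL(2, ℝ) :=
    have : SecondCountableTopology (Matrix (Fin 2) (Fin 2) ℝ) :=
      inferInstanceAs (SecondCountableTopology (Fin 2 → Fin 2 → ℝ))
    Matrix.SpecialLinearGroup.isClosedEmbedding_val.isEmbedding.secondCountableTopology
  exact inferInstanceAs (SecondCountableTopology (SL(2, ℝ) ⧸ Subgroup.center SL(2, ℝ)))

/-- A discrete subspace of a second countable space is countable. -/
lemma IsCompactSurfaceGroup.countable {Γ : Subgroup PSL(2, ℝ)} (hΓ : IsCompactSurfaceGroup Γ) :
    Countable Γ :=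
  have := hΓ.discrete
  countable_of_Lindelof_of_discrete

/-! ### The representation on `Vⁿ` -/

section Representation

variable {V : Type*} [NormedAddCommGroup V] [InnerProductSpace ℂ V] {n : ℕ}
  {Γ : Subgroup PSL(2, ℝ)}

/-- The unitary representation `(ϱ(γ) v)_{φ(γ) j} = ρ(γ) v_j` of `Γ` on `Vⁿ`. -/
def permRep (φ : Γ →* Equiv.Perm (Fin n)) (ρ : Γ →* (V ≃ₗᵢ[ℂ] V)) :
    Γ →* (PiLp 2 (fun _ : Fin n => V) ≃ₗᵢ[ℂ] PiLp 2 (fun _ : Fin n => V)) where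
  toFun γ := (LinearIsometryEquiv.piLpCongrRight 2 fun _ => ρ γ).trans
    (LinearIsometryEquiv.piLpCongrLeft 2 ℂ V (φ γ))
  map_one' := by
    ext v j
    rw [map_one, map_one]
    rfl
  map_mul' a b := by
    ext v j
    rw [map_mul, map_mul]
    rfl

variable (φ : Γ →* Equiv.Perm (Fin n)) (ρ : Γ →* (V ≃ₗᵢ[ℂ] V))

lemma mul_apply_apply (a b : Γ) (v : V) : ρ (a * b) v = ρ a (ρ b v) := by
  rw [map_mul]
  rfl

lemma permRep_apply (γ : Γ) (v : PiLp 2 (fun _ : Fin n => V)) (j : Fin n) :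
    permRep φ ρ γ v j = ρ γ (v ((φ γ).symm j)) := rfl

lemma permRep_apply_perm (γ : Γ) (v : PiLp 2 (fun _ : Fin n => V)) (j : Fin n) :
    permRep φ ρ γ v (φ γ j) = ρ γ (v j) := by
  rw [permRep_apply, Equiv.symm_apply_apply]

lemma finrank_piLp [FiniteDimensional ℂ V] :
    Module.finrank ℂ (PiLp 2 (fun _ : Fin n => V)) = n * Module.finrank ℂ V := by
  rw [(WithLp.linearEquiv 2 ℂ (Fin n → V)).finrank_eq, Module.finrank_pi_fintype]
  simp

/-- The inclusion of the `j`-th summand of `Vⁿ`. -/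
def incl (j : Fin n) : V →ₗ[ℂ] PiLp 2 (fun _ : Fin n => V) :=
  (WithLp.linearEquiv 2 ℂ (Fin n → V)).symm.toLinearMap ∘ₗ LinearMap.single ℂ (fun _ => V) j

lemma incl_apply (j k : Fin n) (v : V) : incl j v k = if k = j then v else 0 :=
  Pi.single_apply j v k

lemma sum_incl (v : PiLp 2 (fun _ : Fin n => V)) : ∑ j, incl j (v j) = v := by
  ext k
  simp [incl_apply]

lemma permRep_incl (γ : Γ) (j : Fin n) (v : V) :
    permRep φ ρ γ (incl j v) = incl (φ γ j) (ρ γ v) := by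
  ext k
  simp only [permRep_apply, incl_apply, Equiv.symm_apply_eq]
  split_ifs <;> simp

lemma incl_hom_ext {W : Type*} [AddCommMonoid W] [Module ℂ W]
    {f g : PiLp 2 (fun _ : Fin n => V) →ₗ[ℂ] W} (h : ∀ j v, f (incl j v) = g (incl j v)) :
    f = g := by
  ext v
  rw [← sum_incl v, map_sum, map_sum]
  exact Finset.sum_congr rfl fun j _ => h j (v j)

/-- The projection to the `j`-th summand of `Vⁿ`. -/
def proj (j : Fin n) : PiLp 2 (fun _ : Fin n => V) →ₗ[ℂ] V :=
  LinearMap.proj j ∘ₗ (WithLp.linearEquiv 2 ℂ (Fin n → V)).toLinearMap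

lemma proj_apply (j : Fin n) (v : PiLp 2 (fun _ : Fin n => V)) : proj j v = v j := rfl

lemma trace_permRep [FiniteDimensional ℂ V] (γ : Γ) :
    LinearMap.trace ℂ _ (toRep (permRep φ ρ) γ) =
      LinearMap.trace ℂ V (toRep ρ γ) * ((Function.fixedPoints (φ γ)).ncard : ℂ) := by
  classical
  have h : toRep (permRep φ ρ) γ = ∑ j, incl (φ γ j) ∘ₗ (toRep ρ γ ∘ₗ proj j) := by
    refine incl_hom_ext fun j v => ?_
    change permRep φ ρ γ (incl j v) = _
    rw [permRep_incl, LinearMap.sum_apply, Finset.sum_eq_single j]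
    · simp only [LinearMap.comp_apply, proj_apply, incl_apply, if_true]
      rfl
    · intro k _ hk
      simp [proj_apply, incl_apply, hk]
    · simp
  have h' (j : Fin n) : LinearMap.trace ℂ _ (incl (φ γ j) ∘ₗ (toRep ρ γ ∘ₗ proj j)) =
      if φ γ j = j then LinearMap.trace ℂ V (toRep ρ γ) else 0 := by
    -- Cyclicity leaves `proj j ∘ₗ incl (φ γ j)`, which is the identity if `j` is fixed and zero
    -- otherwise.
    rw [LinearMap.trace_comp_comm', LinearMap.comp_assoc]
    have : proj j ∘ₗ incl (φ γ j) =
        if φ γ j = j then (LinearMap.id : V →ₗ[ℂ] V) else 0 := by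
      ext v
      rw [LinearMap.comp_apply, proj_apply, incl_apply]
      split_ifs with h₁ h₂ h₂
      · rfl
      · exact absurd h₁.symm h₂
      · exact absurd h₂.symm h₁
      · rfl
    rw [this]
    split_ifs <;> simp
  have hcard : Function.fixedPoints (φ γ) = ↑(Finset.univ.filter fun j => φ γ j = j) := by
    ext j
    simp [Function.mem_fixedPoints, Function.IsFixedPt]
  rw [h, map_sum, hcard, Set.ncard_coe_finset]
  simp only [h']
  rw [← Finset.sum_filter, Finset.sum_const, nsmul_eq_mul, mul_comm]

/-! ### Comparison with the induced representation -/

/-- The restriction of `ρ` to the stabilizer of `i`. -/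
abbrev stabRep (i : Fin n) : Representation ℂ (stab φ i) V :=
  (toRep ρ).comp (stab φ i).subtype

/-- The map from the induced representation to `Vⁿ` sending the class of `h ⊗ v` to `ρ(h⁻¹) v` in
the summand `φ(h⁻¹) i`. -/
def fromInd (i : Fin n) :
    Representation.IndV (stab φ i).subtype (stabRep φ ρ i) →ₗ[ℂ] PiLp 2 (fun _ : Fin n => V) :=
  Representation.Coinvariants.lift _
    (TensorProduct.lift <| (Finsupp.lift _ _ _ fun h : Γ =>
        incl (φ h⁻¹ i) ∘ₗ toRep ρ h⁻¹) ∘ₗ (MonoidAlgebra.coeffLinearEquiv ℂ).toLinearMap) <| by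
    rintro ⟨s, hs⟩
    -- The coinvariants identify `s * h ⊗ ρ s v` with `h ⊗ v`; the stabilizer multiplies on the
    -- left, whence the inverses in the formula.
    have hs' : φ s⁻¹ i = i := (stab φ i).inv_mem hs
    ext h v
    have h₁ : φ (s * h)⁻¹ i = φ h⁻¹ i := by
      rw [mul_inv_rev, map_mul, Equiv.Perm.mul_apply, hs']
    have h₂ : ρ (s * h)⁻¹ (ρ s v) = ρ h⁻¹ v := by
      rw [← mul_apply_apply, mul_inv_rev, inv_mul_cancel_right]
    have h₃ : incl (φ (s * h)⁻¹ i) (toRep ρ (s * h)⁻¹ (toRep ρ s v)) =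
        incl (φ h⁻¹ i) (toRep ρ h⁻¹ v) := by
      rw [h₁]
      exact congrArg _ h₂
    simpa [-mul_inv_rev, -map_inv, -map_mul] using
      congrArg (fun w : PiLp 2 (fun _ : Fin n => V) => w _) h₃

lemma fromInd_mk (i : Fin n) (h : Γ) (v : V) :
    fromInd φ ρ i (Representation.IndV.mk _ _ h v) = incl (φ h⁻¹ i) (ρ h⁻¹ v) := by
  have : fromInd φ ρ i (Representation.IndV.mk _ _ h v) =
      incl (φ h⁻¹ i) (toRep ρ h⁻¹ v) := by
    simp [fromInd]
  exact this

lemma indV_mk_mul (i : Fin n) (s : Γ) (hs : φ s i = i) (h : Γ) (v : V) :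
    Representation.IndV.mk (stab φ i).subtype (stabRep φ ρ i) (s * h) (ρ s v) =
      Representation.IndV.mk (stab φ i).subtype (stabRep φ ρ i) h v := by
  have := Representation.Coinvariants.mk_self_apply
    (Representation.tprod ((Representation.leftRegular ℂ Γ).comp (stab φ i).subtype)
      (stabRep φ ρ i)) (⟨s, hs⟩ : stab φ i)
    (TensorProduct.tmul ℂ (MonoidAlgebra.single h (1 : ℂ)) v)
  rw [Representation.tprod_apply, TensorProduct.map_tmul] at this
  refine Eq.trans ?_ this
  simp
  rfl

lemma ind_apply_mk (i : Fin n) (g h : Γ) (v : V) :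
    Representation.ind (stab φ i).subtype (stabRep φ ρ i) g (Representation.IndV.mk _ _ h v) =
      Representation.IndV.mk _ _ (h * g⁻¹) v :=
  Representation.ind_mk _ _ g h v

variable {φ} (R : Set (Fin n))

/-- The map from the direct sum of the induced representations to `Vⁿ`. -/
def fromInducedRep : (DirectSum R fun i : R =>
    Representation.IndV (stab φ (i : Fin n)).subtype (stabRep φ ρ i)) →ₗ[ℂ]
      PiLp 2 (fun _ : Fin n => V) :=
  DirectSum.toModule ℂ R _ fun i => fromInd φ ρ i

variable {R}

/-- The representative in `R` of the orbit of `j`. -/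
def orbitRep (hR : IsOrbitTransversal φ R) (j : Fin n) : R :=
  ⟨(hR j).choose, (hR j).choose_spec.1.1⟩

/-- An element of `Γ` carrying the representative of the orbit of `j` to `j`. -/
def orbitElt (hR : IsOrbitTransversal φ R) (j : Fin n) : Γ :=
  (hR j).choose_spec.1.2.choose

lemma orbitElt_spec (hR : IsOrbitTransversal φ R) (j : Fin n) :
    φ (orbitElt hR j) (orbitRep hR j) = j :=
  (hR j).choose_spec.1.2.choose_spec

lemma orbitRep_eq (hR : IsOrbitTransversal φ R) {j : Fin n} {i : R} {γ : Γ} (h : φ γ i = j) :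
    orbitRep hR j = i :=
  Subtype.ext ((hR j).choose_spec.2 i ⟨i.2, γ, h⟩).symm

/-- The map from `Vⁿ` to the direct sum of the induced representations. -/
def toInducedRep (hR : IsOrbitTransversal φ R) :
    PiLp 2 (fun _ : Fin n => V) →ₗ[ℂ] DirectSum R fun i : R =>
      Representation.IndV (stab φ (i : Fin n)).subtype (stabRep φ ρ i) :=
  ∑ j, DirectSum.lof ℂ R _ (orbitRep hR j) ∘ₗ
    Representation.IndV.mk _ _ (orbitElt hR j)⁻¹ ∘ₗ toRep ρ (orbitElt hR j)⁻¹ ∘ₗ proj j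

/-- The chosen `orbitElt` may be replaced by any `γ` carrying `i` to the given point: the two differ
by an element of the stabilizer, which the coinvariants absorb. -/
lemma toInducedRep_incl (hR : IsOrbitTransversal φ R) (i : R) (γ : Γ) (v : V) :
    toInducedRep ρ hR (incl (φ γ i) v) =
      DirectSum.lof ℂ R (fun i : R =>
        Representation.IndV (stab φ (i : Fin n)).subtype (stabRep φ ρ i)) i
        (Representation.IndV.mk _ _ γ⁻¹ (ρ γ⁻¹ v)) := by
  have h₁ : toInducedRep ρ hR (incl (φ γ i) v) =
      DirectSum.lof ℂ R (fun i : R =>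
        Representation.IndV (stab φ (i : Fin n)).subtype (stabRep φ ρ i)) (orbitRep hR (φ γ i))
        (Representation.IndV.mk _ _ (orbitElt hR (φ γ i))⁻¹ (ρ (orbitElt hR (φ γ i))⁻¹ v)) := by
    rw [toInducedRep, LinearMap.sum_apply, Finset.sum_eq_single (φ γ i)]
    · simp only [LinearMap.comp_apply, proj_apply, incl_apply, if_true]
      rfl
    · intro k _ hk
      simp [proj_apply, incl_apply, hk]
    · simp
  rw [h₁]
  have h₂ := orbitElt_spec hR (φ γ i)
  have h₃ : orbitRep hR (φ γ i) = i := orbitRep_eq hR rfl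
  generalize orbitElt hR (φ γ i) = δ at h₂
  generalize orbitRep hR (φ γ i) = i' at h₂ h₃
  subst h₃
  congr 1
  have hs : φ (δ⁻¹ * γ) i' = i' := by
    rw [map_mul, Equiv.Perm.mul_apply, ← h₂, ← Equiv.Perm.mul_apply, ← map_mul, inv_mul_cancel,
      map_one, Equiv.Perm.one_apply]
  have := indV_mk_mul φ ρ i' (δ⁻¹ * γ) hs γ⁻¹ (ρ γ⁻¹ v)
  rw [← this, ← mul_apply_apply, mul_inv_cancel_right]

lemma fromInducedRep_lof_mk (i : R) (h : Γ) (v : V) :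
    fromInducedRep ρ R (DirectSum.lof ℂ R (fun i : R =>
      Representation.IndV (stab φ (i : Fin n)).subtype (stabRep φ ρ i)) i
        (Representation.IndV.mk _ _ h v)) = incl (φ h⁻¹ i) (ρ h⁻¹ v) := by
  rw [fromInducedRep, DirectSum.toModule_lof]
  exact fromInd_mk φ ρ i h v

lemma toInducedRep_comp_fromInducedRep (hR : IsOrbitTransversal φ R) :
    toInducedRep ρ hR ∘ₗ fromInducedRep ρ R = LinearMap.id := by
  refine DirectSum.linearMap_ext _ fun i => ?_
  refine Representation.IndV.hom_ext _ _ fun h => LinearMap.ext fun v => ?_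
  change toInducedRep ρ hR (fromInducedRep ρ R (DirectSum.lof ℂ R _ i
    (Representation.IndV.mk _ _ h v))) = DirectSum.lof ℂ R _ i (Representation.IndV.mk _ _ h v)
  rw [fromInducedRep_lof_mk, toInducedRep_incl, ← mul_apply_apply, inv_inv, mul_inv_cancel,
    map_one]
  rfl

lemma fromInducedRep_comp_toInducedRep (hR : IsOrbitTransversal φ R) :
    fromInducedRep ρ R ∘ₗ toInducedRep ρ hR = LinearMap.id := by
  refine incl_hom_ext fun j v => ?_
  obtain ⟨i, ⟨hi, γ, rfl⟩, -⟩ := hR j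
  rw [LinearMap.comp_apply, toInducedRep_incl ρ hR ⟨i, hi⟩, fromInducedRep_lof_mk,
    ← mul_apply_apply, inv_inv, mul_inv_cancel, map_one]
  rfl

/-- `Vⁿ` is linearly equivalent to the direct sum of the induced representations. -/
def inducedRepEquiv (hR : IsOrbitTransversal φ R) :
    PiLp 2 (fun _ : Fin n => V) ≃ₗ[ℂ] DirectSum R fun i : R =>
      Representation.IndV (stab φ (i : Fin n)).subtype (stabRep φ ρ i) :=
  LinearEquiv.ofLinearMap (toInducedRep ρ hR) (fromInducedRep ρ R)
    (toInducedRep_comp_fromInducedRep ρ hR) (fromInducedRep_comp_toInducedRep ρ hR)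

lemma inducedRep_lof_mk (g : Γ) (i : R) (h : Γ) (v : V) :
    inducedRep φ ρ R g (DirectSum.lof ℂ R (fun i : R =>
      Representation.IndV (stab φ (i : Fin n)).subtype (stabRep φ ρ i)) i
        (Representation.IndV.mk _ _ h v)) =
      DirectSum.lof ℂ R _ i (Representation.IndV.mk _ _ (h * g⁻¹) v) := by
  refine (DirectSum.lmap_lof (fun i : R => Representation.ind (stab φ (i : Fin n)).subtype
    (stabRep φ ρ i) g) i _).trans ?_
  exact congrArg _ (ind_apply_mk φ ρ i g h v)

lemma toInducedRep_permRep_incl (hR : IsOrbitTransversal φ R) (g γ : Γ) (i : R) (v : V) :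
    toInducedRep ρ hR (permRep φ ρ g (incl (φ γ i) v)) =
      inducedRep φ ρ R g (toInducedRep ρ hR (incl (φ γ i) v)) := by
  have h₁ : permRep φ ρ g (incl (φ γ i) v) = incl (φ (g * γ) i) (ρ g v) := by
    rw [permRep_incl, map_mul, Equiv.Perm.mul_apply]
  have h₂ : ρ (g * γ)⁻¹ (ρ g v) = ρ γ⁻¹ v := by
    rw [← mul_apply_apply, mul_inv_rev, inv_mul_cancel_right]
  have h₃ : Representation.IndV.mk (stab φ (i : Fin n)).subtype (stabRep φ ρ i) (g * γ)⁻¹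
      (ρ (g * γ)⁻¹ (ρ g v)) = Representation.IndV.mk _ _ (γ⁻¹ * g⁻¹) (ρ γ⁻¹ v) := by
    rw [h₂, mul_inv_rev]
  exact (congrArg _ h₁).trans <| (toInducedRep_incl ρ hR i (g * γ) (ρ g v)).trans <|
    (congrArg _ h₃).trans <| (inducedRep_lof_mk ρ g i γ⁻¹ (ρ γ⁻¹ v)).symm.trans <|
    congrArg _ (toInducedRep_incl ρ hR i γ v).symm

lemma toInducedRep_permRep (hR : IsOrbitTransversal φ R) (g : Γ)
    (v : PiLp 2 (fun _ : Fin n => V)) :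
    toInducedRep ρ hR (permRep φ ρ g v) = inducedRep φ ρ R g (toInducedRep ρ hR v) := by
  have h : toInducedRep ρ hR ∘ₗ toRep (permRep φ ρ) g =
      inducedRep φ ρ R g ∘ₗ toInducedRep ρ hR := by
    refine incl_hom_ext fun j v => ?_
    have hj := toInducedRep_permRep_incl ρ hR g (orbitElt hR j) (orbitRep hR j) v
    rwa [orbitElt_spec] at hj
  exact LinearMap.congr_fun h v

/-- The representation on `Vⁿ` is the direct sum of induced representations. -/
lemma nonempty_permRep_equiv_inducedRep (hR : IsOrbitTransversal φ R) :
    Nonempty ((toRep (permRep φ ρ)).Equiv (inducedRep φ ρ R)) :=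
  ⟨.mk (inducedRepEquiv ρ hR) fun g => LinearMap.ext fun v => toInducedRep_permRep ρ hR g v⟩

end Representation

/-! ### The cover Laplacian as a twisted Laplacian -/

section Cover

open scoped Pointwise

variable {V : Type*} [NormedAddCommGroup V] [InnerProductSpace ℂ V] {n : ℕ}
  {Γ : Subgroup PSL(2, ℝ)} (φ : Γ →* Equiv.Perm (Fin n)) (ρ : Γ →* (V ≃ₗᵢ[ℂ] V))

lemma measurableConstSMul_coverAction :
    letI := coverAction φ
    MeasurableConstSMul Γ (ℍ × Fin n) :=
  let := coverAction φ
  ⟨fun γ => ((measurable_const_smul γ).comp measurable_fst).prodMk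
    ((measurable_of_finite (φ γ)).comp measurable_snd)⟩

lemma measurePreserving_perm_count (σ : Equiv.Perm (Fin n)) :
    MeasurePreserving σ Measure.count Measure.count := by
  refine ⟨measurable_of_finite σ, ?_⟩
  ext s hs
  rw [Measure.map_apply (measurable_of_finite σ) hs, ← Equiv.image_symm_eq_preimage]
  exact Measure.count_injective_image σ.symm.injective s

lemma smulInvariantMeasure_coverAction :
    letI := coverAction φ
    SMulInvariantMeasure Γ (ℍ × Fin n) (coverVolume n) :=
  let := coverAction φ
  ⟨fun γ _ hs => ((measurePreserving_smul γ (volume : Measure ℍ)).prod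
    (measurePreserving_perm_count (φ γ))).measure_preimage hs.nullMeasurableSet⟩

lemma coverVolume_restrict_prod_univ (F : Set ℍ) :
    (coverVolume n).restrict (F ×ˢ Set.univ) = (volume.restrict F).prod Measure.count := by
  rw [coverVolume, ← Measure.prod_restrict, Measure.restrict_univ]

/-- Translates of `F × [n]` lie over translates of `F`. This is the intermediate domain between `D`
and `F`. -/
lemma isCoverFundamentalDomain_prod_univ {F : Set ℍ} (hFm : MeasurableSet F)
    (hF : IsFundamentalDomain Γ F) : IsCoverFundamentalDomain φ (F ×ˢ Set.univ) := by
  let := coverAction φ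
  change IsFundamentalDomain Γ (F ×ˢ Set.univ) (coverVolume n)
  have hsmul (γ : Γ) : γ • (F ×ˢ (Set.univ : Set (Fin n))) ⊆ (γ • F) ×ˢ Set.univ := by
    rintro _ ⟨x, hx, rfl⟩
    exact ⟨⟨x.1, hx.1, rfl⟩, trivial⟩
  refine ⟨(hFm.prod MeasurableSet.univ).nullMeasurableSet, ?_, fun a b hab => ?_⟩
  · have := Measure.quasiMeasurePreserving_fst (μ := (volume : Measure ℍ))
      (ν := (Measure.count : Measure (Fin n)))
    filter_upwards [this.ae hF.ae_covers] with x ⟨γ, hγ⟩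
    exact ⟨γ, hγ, trivial⟩
  · refine measure_mono_null (t := ((a • F) ∩ (b • F)) ×ˢ Set.univ) ?_ ?_
    · rintro x ⟨hxa, hxb⟩
      exact ⟨⟨(hsmul a hxa).1, (hsmul b hxb).1⟩, trivial⟩
    · have h : volume ((a • F) ∩ (b • F)) = 0 := hF.aedisjoint hab
      rw [coverVolume, Measure.prod_prod, h, zero_mul]

/-- The functions `f : ℍ × [n] → V` with `f (γ z, φ(γ) j) = ρ(γ) f(z, j)`. -/
def coverEquivariantFunctions : Submodule ℂ (ℍ × Fin n → V) :=
  letI := coverAction φ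
  equivariantFunctions (ℍ × Fin n) ρ

lemma mem_coverEquivariantFunctions_iff (f : ℍ × Fin n → V) :
    f ∈ coverEquivariantFunctions φ ρ ↔
      ∀ (γ : Γ) (z : ℍ) (j : Fin n), f (γ • z, φ γ j) = ρ γ (f (z, j)) :=
  ⟨fun h γ z j => h γ (z, j), fun h γ p => h γ p.1 p.2⟩

lemma curryPi_mem_equivariantFunctions_iff (f : ℍ × Fin n → V) :
    curryPi f ∈ equivariantFunctions ℍ (permRep φ ρ) ↔ f ∈ coverEquivariantFunctions φ ρ := by
  rw [mem_coverEquivariantFunctions_iff]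
  refine forall_congr' fun γ => forall_congr' fun z => ?_
  -- Coordinates are compared at `φ γ j`, where `permRep` has a formula free of inverses.
  rw [PiLp.ext_iff, ← (φ γ).forall_congr_right]
  simp only [permRep_apply_perm, curryPi_apply]

lemma curryPi_surjective :
    Function.Surjective (curryPi : (ℍ × Fin n → V) → ℍ → PiLp 2 (fun _ : Fin n => V)) :=
  fun f => ⟨fun p => f p.1 p.2, rfl⟩

lemma isSmooth_curryPi_iff (ψ : ℍ × Fin n → V) :
    IsSmooth (curryPi ψ) ↔ ∀ j, IsSmooth fun z => ψ (z, j) :=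
  contDiffOn_piLp 2

lemma curryPi_mem_sections_iff (ψ : ℍ × Fin n → V) :
    curryPi ψ ∈ sections (permRep φ ρ) ↔ ψ ∈ coverSections φ ρ :=
  and_congr (isSmooth_curryPi_iff ψ) ((curryPi_mem_equivariantFunctions_iff φ ρ ψ).trans
    (mem_coverEquivariantFunctions_iff φ ρ ψ))

variable {φ ρ}

lemma coverSections_le : coverSections φ ρ ≤ coverEquivariantFunctions φ ρ :=
  fun ψ hψ => (mem_coverEquivariantFunctions_iff φ ρ ψ).2 hψ.2

/-- The Laplacian commutes with the isometry `γ` and with the constant map `ρ γ`. Equivariance is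
needed because the unitary map is known explicitly only on equivariant representatives. -/
lemma coverSectionsLaplacian_mem (ψ : coverSections φ ρ) :
    coverSectionsLaplacian φ ρ ψ ∈ coverEquivariantFunctions φ ρ := by
  rw [mem_coverEquivariantFunctions_iff]
  intro γ z j
  change hypLaplacian (fun w => (ψ : ℍ × Fin n → V) (w, φ γ j)) ((γ : PSL(2, ℝ)) • z) =
    ρ γ (hypLaplacian (fun w => (ψ : ℍ × Fin n → V) (w, j)) z)
  rw [← hypLaplacian_comp_smul (ψ.2.1 (φ γ j))]
  have h : (fun w : ℍ => (ψ : ℍ × Fin n → V) ((γ : PSL(2, ℝ)) • w, φ γ j)) =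
      fun w => ρ γ ((ψ : ℍ × Fin n → V) (w, j)) := funext fun w => ψ.2.2 γ w j
  rw [h]
  exact hypLaplacian_clm_comp (ψ.2.1 j) (ρ γ).toContinuousLinearEquiv.toContinuousLinearMap z

lemma hypLaplacian_curryPi (ψ : coverSections φ ρ) :
    hypLaplacian (curryPi (ψ : ℍ × Fin n → V)) = curryPi (coverSectionsLaplacian φ ρ ψ) := by
  funext z
  ext j
  exact (hypLaplacian_clm_comp ((isSmooth_curryPi_iff _).2 ψ.2.1)
    (PiLp.proj 2 (fun _ : Fin n => V) j) z).symm

variable (φ ρ) in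
-- Independence of the fundamental domain replaces `D` by `F × [n]`; currying then passes to `F`.
lemma sameL2_cover [Countable Γ] {F : Set ℍ} {D : Set (ℍ × Fin n)} (hFm : MeasurableSet F)
    (hF : IsFundamentalDomain Γ F) (hD : IsCoverFundamentalDomain φ D) :
    SameL2 (coverEquivariantFunctions φ ρ).subtype
      (curryPi ∘ₗ (coverEquivariantFunctions φ ρ).subtype)
      ((coverVolume n).restrict D) (volume.restrict F) := by
  let := coverAction φ
  have := measurableConstSMul_coverAction φ
  have := smulInvariantMeasure_coverAction φ
  have hFn := isCoverFundamentalDomain_prod_univ φ hFm hF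
  have hmeas (f : coverEquivariantFunctions φ ρ) :
      AEStronglyMeasurable (f : ℍ × Fin n → V) ((coverVolume n).restrict D) ↔
        AEStronglyMeasurable (f : ℍ × Fin n → V) ((volume.restrict F).prod Measure.count) := by
    rw [← coverVolume_restrict_prod_univ]
    exact aestronglyMeasurable_restrict_iff_of_equivariant hD hFn f.2
  refine ⟨fun f => (hmeas f).trans (aestronglyMeasurable_curryPi_iff _), fun f hf => ?_⟩
  refine Eq.trans ?_ (eLpNorm_curryPi _ ((hmeas f).1 hf))
  rw [← coverVolume_restrict_prod_univ]
  exact eLpNorm_restrict_eq_of_equivariant hD hFn f.2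

lemma exists_coverEquivariant_ae_eq [Countable Γ] {D : Set (ℍ × Fin n)} (hDm : MeasurableSet D)
    (hD : IsCoverFundamentalDomain φ D) (u : Lp V 2 ((coverVolume n).restrict D)) :
    ∃ f, u =ᵐ[(coverVolume n).restrict D] (coverEquivariantFunctions φ ρ).subtype f := by
  let := coverAction φ
  obtain ⟨f, hf, h⟩ := exists_equivariant_ae_eq hD hDm ρ u
  exact ⟨⟨f, hf⟩, h⟩

lemma exists_curryPi_ae_eq [Countable Γ] {F : Set ℍ} (hFm : MeasurableSet F)
    (hF : IsFundamentalDomain Γ F) (w : Lp (PiLp 2 (fun _ : Fin n => V)) 2 (volume.restrict F)) :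
    ∃ f, w =ᵐ[volume.restrict F]
      (curryPi ∘ₗ (coverEquivariantFunctions φ ρ).subtype) f := by
  obtain ⟨f', hf', h⟩ := exists_equivariant_ae_eq hF hFm (permRep φ ρ) w
  obtain ⟨f, rfl⟩ := curryPi_surjective f'
  exact ⟨⟨f, (curryPi_mem_equivariantFunctions_iff φ ρ f).1 hf'⟩, h⟩

variable (φ ρ) in
/-- The Laplacian of the cover is unitarily equivalent to a twisted Laplacian of the base. -/
theorem exists_intertwines_coverLaplacian [Countable Γ] {F : Set ℍ} {D : Set (ℍ × Fin n)}
    (hFm : MeasurableSet F) (hF : IsFundamentalDomain Γ F) (hDm : MeasurableSet D)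
    (hD : IsCoverFundamentalDomain φ D) :
    ∃ T : Lp V 2 ((coverVolume n).restrict D) ≃ₗᵢ[ℂ]
        Lp (PiLp 2 (fun _ : Fin n => V)) 2 (volume.restrict F),
      Intertwines T.toContinuousLinearEquiv (coverLaplacian φ ρ D)
        (twistedLaplacian (permRep φ ρ) F) := by
  let h := sameL2_cover φ ρ hFm hF hD
  let T := h.equiv (exists_coverEquivariant_ae_eq hDm hD) (exists_curryPi_ae_eq hFm hF)
  have hT (u) (f : ℍ × Fin n → V) (hf : f ∈ coverEquivariantFunctions φ ρ) :
      T u =ᵐ[volume.restrict F] curryPi f ↔ u =ᵐ[(coverVolume n).restrict D] f :=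
    h.equiv_ae_eq_iff _ _ u ⟨f, hf⟩
  -- It suffices to match the graphs on smooth sections; the closures follow.
  refine ⟨T, intertwines_toLinearPMap (mem_topologicalClosure_prod_iff fun x y => ?_)⟩
  constructor
  · rintro ⟨⟨ψ', hψ'⟩, h₁, h₂⟩
    obtain ⟨ψ, rfl⟩ := curryPi_surjective ψ'
    have hψ := (curryPi_mem_sections_iff φ ρ ψ).1 hψ'
    refine ⟨⟨ψ, hψ⟩, (hT x ψ (coverSections_le hψ)).1 h₁,
      (hT y _ (coverSectionsLaplacian_mem ⟨ψ, hψ⟩)).1 ?_⟩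
    rw [← hypLaplacian_curryPi]
    exact h₂
  · rintro ⟨⟨ψ, hψ⟩, h₁, h₂⟩
    refine ⟨⟨curryPi ψ, (curryPi_mem_sections_iff φ ρ ψ).2 hψ⟩,
      (hT x ψ (coverSections_le hψ)).2 h₁, ?_⟩
    have := (hT y _ (coverSectionsLaplacian_mem ⟨ψ, hψ⟩)).2 h₂
    rwa [← hypLaplacian_curryPi] at this

end Cover

end TwistedLaplacian

end

theorem mainTheorem7
    (Γ : Subgroup PSL(2, ℝ)) (hΓ : TwistedLaplacian.IsCompactSurfaceGroup Γ)
    {V : Type*} [NormedAddCommGroup V] [InnerProductSpace ℂ V] [FiniteDimensional ℂ V]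
    (ρ : Γ →* (V ≃ₗᵢ[ℂ] V)) (n : ℕ) (φ : Γ →* Equiv.Perm (Fin n)) :
    ∃ ϱ : Γ →* (PiLp 2 (fun _ : Fin n => V) ≃ₗᵢ[ℂ] PiLp 2 (fun _ : Fin n => V)),
      Module.finrank ℂ (PiLp 2 (fun _ : Fin n => V)) = n * Module.finrank ℂ V ∧
      (∀ R : Set (Fin n), TwistedLaplacian.IsOrbitTransversal φ R →
        Nonempty ((TwistedLaplacian.toRep ϱ).Equiv (TwistedLaplacian.inducedRep φ ρ R))) ∧
      (∀ (F : Set ℍ) (D : Set (ℍ × Fin n)),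
        IsCompact F → MeasureTheory.IsFundamentalDomain Γ F (MeasureTheory.volume) →
        IsCompact D → TwistedLaplacian.IsCoverFundamentalDomain φ D →
        TwistedLaplacian.spectrum (TwistedLaplacian.coverLaplacian φ ρ D) =
            TwistedLaplacian.spectrum (TwistedLaplacian.twistedLaplacian ϱ F) ∧
          ∀ c : ℂ,
            Module.rank ℂ (TwistedLaplacian.eigenspace
                (TwistedLaplacian.coverLaplacian φ ρ D) c) =
              Module.rank ℂ (TwistedLaplacian.eigenspace
                (TwistedLaplacian.twistedLaplacian ϱ F) c)) ∧
      ∀ γ : Γ,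
        LinearMap.trace ℂ _ (TwistedLaplacian.toRep ϱ γ) =
          LinearMap.trace ℂ V (TwistedLaplacian.toRep ρ γ) *
            ((Function.fixedPoints (φ γ)).ncard : ℂ) := by
  have := hΓ.countable
  refine ⟨TwistedLaplacian.permRep φ ρ, TwistedLaplacian.finrank_piLp,
    fun R hR => TwistedLaplacian.nonempty_permRep_equiv_inducedRep ρ hR,
    fun F D hFc hF hDc hD => ?_, fun γ => TwistedLaplacian.trace_permRep φ ρ γ⟩
  obtain ⟨T, hT⟩ := TwistedLaplacian.exists_intertwines_coverLaplacian φ ρ hFc.measurableSet hF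
    hDc.measurableSet hD
  exact ⟨hT.spectrum_eq, hT.rank_eigenspace_eq⟩
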